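/- All graphs are finite and simple. The treedepth $\mathrm{td}(G)$ of a graph $G$ is the minimum integer $d$ for which there exists a rooted forest $F$ with vertex set $V(G)$ in which every root-to-leaf path has at most $d$ vertices, and such that every edge of $G$ joins a vertex to one of its ancestors or descendants in $F$. A graph is chordal if it contains no induced cycle of length at least $4$. A class $\mathcal{G}$ of graphs is fractionally $\mathrm{td}$-fragile at a rate $r$ (a non-decreasing function from $\mathbb{N}$ to the non-negative reals) if for every $G\in\mathcal{G}$ and every positive integer $a$ there exists a probability distribution on the subsets $Y\subseteq V(G)$ satisfying $\mathrm{td}(G-Y)\le r(a)$, such that each vertex of $G$ belongs to a set sampled from this distribution with probability at most $1/a$. Theorem. The class of planar chordal graphs is fractionally $\mathrm{td}$-fragile at rate $r(a)=8a^2\bigl(2+\lceil\log_2 a\rceil\bigr)$, where $r(0)=0$. -/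

import Mathlib

open scoped NNReal ENNReal

universe u

namespace Fragility

/-! ### Graph parameters and graph classes (all graphs are finite and simple) -/

/-- A graph parameter: a non-negative real number for every finite graph, invariant under
isomorphism. -/
structure GraphParameter where
  val : ∀ {V : Type u} [Finite V], SimpleGraph V → ℝ≥0
  val_eq_of_iso : ∀ {V W : Type u} [Finite V] [Finite W] (G : SimpleGraph V) (H : SimpleGraph W),
    (G ≃g H) → val G = val H

/-- A class of finite graphs. -/
abbrev GraphClass := ∀ (V : Type u) [Finite V], SimpleGraph V → Prop

/-! ### Fractional fragility -/

/-- The set of all `Y ⊆ V(G)` such that `f (G - Y) ≤ b`. -/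
def deletionSets (f : GraphParameter.{u}) {V : Type u} [Finite V] (G : SimpleGraph V) (b : ℝ) :
    Set (Set V) :=
  {Y | (f.val (G.induce Yᶜ) : ℝ) ≤ b}

/-- A probability distribution on the subsets of `V` is `ε`-thin if every vertex belongs to the
random set with probability at most `ε`. -/
def IsThin {V : Type u} (ε : ℝ) (μ : PMF (Set V)) : Prop :=
  ∀ v : V, μ.toOuterMeasure {Y | v ∈ Y} ≤ ENNReal.ofReal ε

/-- `G` is fractionally `f`-fragile at the (non-decreasing) rate `r`. -/
def IsFractionallyFragile (f : GraphParameter.{u}) (r : ℕ → ℝ≥0) {V : Type u} [Finite V]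
    (G : SimpleGraph V) : Prop :=
  Monotone r ∧ ∀ a : ℕ, 0 < a →
    ∃ μ : PMF (Set V), μ.support ⊆ deletionSets f G (r a) ∧ IsThin (1 / (a : ℝ)) μ

/-- A class is fractionally `f`-fragile at rate `r` if each graph from the class is. -/
def GraphClass.IsFractionallyFragile (𝒢 : GraphClass.{u}) (f : GraphParameter.{u})
    (r : ℕ → ℝ≥0) : Prop :=
  ∀ (V : Type u) [Finite V] (G : SimpleGraph V), 𝒢 V G → Fragility.IsFractionallyFragile f r G

/-! ### Treedepth -/

/-- A rooted forest with vertex set `V`: every vertex is a root or has a parent, and `depth` is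
the number of edges on the path from a vertex to the root of its tree. The existence of `depth`
says that the parent map has no cycles. -/
structure RootedForest (V : Type u) where
  parent : V → Option V
  depth : V → ℕ
  depth_root : ∀ v, parent v = none → depth v = 0
  depth_child : ∀ v p, parent v = some p → depth v = depth p + 1

/-- `F.IsAncestor u v`: iterating the parent map (zero or more times) from `v` leads to `u`. -/
def RootedForest.IsAncestor {V : Type u} (F : RootedForest V) (u v : V) : Prop :=
  Relation.ReflTransGen (fun x y => F.parent x = some y) v u

/-- There is a rooted forest of depth at most `d - 1` on `V(G)` (that is, every root-to-leaf path
has at most `d` vertices) such that every edge of `G` joins a vertex to one of its ancestors or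
descendants. -/
def HasTreedepthAtMost {V : Type u} (G : SimpleGraph V) (d : ℕ) : Prop :=
  ∃ F : RootedForest V, (∀ v, F.depth v < d) ∧
    ∀ u v, G.Adj u v → F.IsAncestor u v ∨ F.IsAncestor v u

theorem HasTreedepthAtMost.of_iso {V W : Type u} {G : SimpleGraph V} {H : SimpleGraph W}
    (e : G ≃g H) {d : ℕ} (h : HasTreedepthAtMost G d) : HasTreedepthAtMost H d := by
  obtain ⟨F, hd, hF⟩ := h
  refine ⟨⟨fun w => (F.parent (e.symm w)).map e, fun w => F.depth (e.symm w), ?_, ?_⟩, ?_, ?_⟩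
  · intro w hw
    exact F.depth_root _ (by simpa using hw)
  · intro w p hp
    obtain ⟨q, hq, rfl⟩ := Option.map_eq_some_iff.1 hp
    simpa using F.depth_child _ _ hq
  · exact fun w => hd _
  · intro x y hxy
    have key : ∀ x y, F.IsAncestor (e.symm x) (e.symm y) →
        Relation.ReflTransGen (fun x y => (F.parent (e.symm x)).map e = some y) y x := by
      intro x y h
      have := Relation.ReflTransGen.lift (r := fun a b => F.parent a = some b)
        (p := fun x y => (F.parent (e.symm x)).map e = some y) e
        (fun a b hab => by simp [Function.onFun, hab]) _ _ h
      simpa [Function.onFun] using this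
    exact (hF _ _ (e.symm.map_rel_iff.2 hxy)).imp (key _ _) (key _ _)

/-- The minimum is over a nonempty set: a finite graph has a witness, namely a rooted path. -/
theorem exists_hasTreedepthAtMost {V : Type u} [Finite V] (G : SimpleGraph V) :
    ∃ d, HasTreedepthAtMost G d := by
  obtain ⟨n, ⟨e⟩⟩ := Finite.exists_equiv_fin V
  let par : Fin n → Option (Fin n) := fun i =>
    if h : (i : ℕ) = 0 then none else some ⟨i - 1, by omega⟩
  have hpar : ∀ i j, par i = some j → (i : ℕ) = j + 1 := by
    intro i j h
    by_cases h0 : (i : ℕ) = 0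
    · simp [par, h0] at h
    · simp only [par, h0, dite_false, Option.some.injEq] at h
      subst h; simp; omega
  let F : RootedForest V :=
    ⟨fun v => (par (e v)).map e.symm, fun v => e v,
      fun v hv => by
        by_contra h0
        simp [par, h0] at hv,
      fun v p hp => by
        obtain ⟨q, hq, rfl⟩ := Option.map_eq_some_iff.1 hp
        simpa using hpar _ _ hq⟩
  have key : ∀ k : ℕ, ∀ u v : V, (e v : ℕ) = e u + k → F.IsAncestor u v := by
    intro k
    induction k with
    | zero =>
      intro u v h
      have : v = u := e.injective (Fin.ext (by simpa using h))
      subst this; exact Relation.ReflTransGen.refl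
    | succ k ih =>
      intro u v h
      have h0 : (e v : ℕ) ≠ 0 := by omega
      refine Relation.ReflTransGen.head (b := e.symm ⟨e v - 1, by omega⟩) ?_ (ih _ _ ?_)
      · simp [F, par, h0]
      · simp; omega
  refine ⟨n, F, fun v => (e v).2, fun u v _ => ?_⟩
  rcases le_total (e u : ℕ) (e v) with h | h
  · exact Or.inl (key (e v - e u) u v (by omega))
  · exact Or.inr (key (e u - e v) v u (by omega))

/-- The least `d` such that `G` has a treedepth witness of depth at most `d - 1`. -/
noncomputable def treedepth {V : Type u} (G : SimpleGraph V) : ℕ :=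
  sInf {d | HasTreedepthAtMost G d}

/-- Treedepth as a graph parameter. -/
noncomputable def td : GraphParameter.{u} where
  val G := (treedepth G : ℝ≥0)
  val_eq_of_iso G H e := by
    have : {d | HasTreedepthAtMost G d} = {d | HasTreedepthAtMost H d} :=
      Set.ext fun _ => ⟨fun h => h.of_iso e, fun h => h.of_iso e.symm⟩
    simp [treedepth, this]

/-! ### Planar chordal graphs -/

/-- The Euclidean plane. -/
abbrev Plane := EuclideanSpace ℝ (Fin 2)

/-- `A` is a simple arc in the plane with ends `p` and `q`. -/
def IsArc (A : Set Plane) (p q : Plane) : Prop :=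
  ∃ γ : Path p q, Function.Injective γ ∧ Set.range γ = A

/-- `G` can be drawn in the plane: vertices are distinct points, every edge is a simple arc between
its ends that contains no other vertex, and two distinct edges meet only in common ends. -/
def IsPlanar {V : Type u} (G : SimpleGraph V) : Prop :=
  ∃ (point : V → Plane) (arc : Sym2 V → Set Plane),
    Function.Injective point ∧
    (∀ u v, G.Adj u v → IsArc (arc s(u, v)) (point u) (point v)) ∧
    (∀ e ∈ G.edgeSet, ∀ w, point w ∈ arc e → w ∈ e) ∧
    (∀ e ∈ G.edgeSet, ∀ e' ∈ G.edgeSet, e ≠ e' →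
      ∀ x ∈ arc e ∩ arc e', ∃ w, w ∈ e ∧ w ∈ e' ∧ x = point w)

/-- `G` is chordal: it contains no induced cycle other than triangles. -/
def IsChordal {V : Type u} (G : SimpleGraph V) : Prop :=
  ∀ n : ℕ, 4 ≤ n → IsEmpty (SimpleGraph.cycleGraph n ↪g G)

/-- The class of planar chordal graphs. -/
def planarChordal : GraphClass.{u} := fun _ _ G => IsPlanar G ∧ IsChordal G

end Fragility

/-!
Fix a breadth-first layering of a chordal graph. The neighbours, in one layer, of a connected set
of vertices above it form a clique, so deleting every `m`-th layer multiplies the treedepth of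
what remains inside the single layers by at most `m`: a walk that leaves a layer can be shortcut
inside it. Apply this to the layers of `G` and again to the layers of each layer. If `G` is planar,
the layers of the second kind are linear forests: the root of the outer layering and the root of
the inner one act as two further vertices adjacent to a whole layer and joined to each other, so a
triangle would give a model of `K₅` and a vertex of degree three a model of `K₃,₃`. These are not
planar by the van Kampen obstruction: the winding numbers of disjoint edges around each other's
ends satisfy linear equations that have no integral solution. Paths of fewer than `2 ^ t` vertices
have treedepth at most `t`, so deleting every `4a`-th vertex of the linear forests suffices. With
`2a` layers of the first and `4a` of the second kind, a common random offset deletes each vertex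
with probability at most `1 / (2a) + 1 / (4a) + 1 / (4a) = 1 / a`.
-/

namespace Fragility

theorem exists_continuous_log {X : Type*} [TopologicalSpace X] [SimplyConnectedSpace X]
    [LocallyPathConnectedSpace X] {g : X → ℂ} (hg : Continuous g) (h0 : ∀ x, g x ≠ 0) :
    ∃ L : X → ℂ, Continuous L ∧ ∀ x, Complex.exp (L x) = g x := by
  obtain ⟨x₀⟩ : Nonempty X := inferInstance
  obtain ⟨L, ⟨-, hL⟩, -⟩ := Complex.isCoveringMapOn_exp.existsUnique_continuousMap_lifts
    ⟨g, hg⟩ (a₀ := x₀) (Complex.exp_log (h0 x₀)) h0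
  exact ⟨L, L.continuous, congrFun hL⟩

theorem sub_eq_sub_of_exp_eq {X : Type*} [TopologicalSpace X] [SimplyConnectedSpace X]
    [LocallyPathConnectedSpace X] {L L' : X → ℂ} (hL : Continuous L) (hL' : Continuous L')
    (h : ∀ x, Complex.exp (L x) = Complex.exp (L' x)) (x y : X) : L y - L x = L' y - L' x := by
  have hshift : ∀ z, Complex.exp (L' z + (L x - L' x)) = Complex.exp (L z) := fun z => by
    rw [Complex.exp_add, Complex.exp_sub, h x, div_self (Complex.exp_ne_zero _), mul_one, h z]
  have hlift := Complex.isCoveringMapOn_exp.existsUnique_continuousMap_lifts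
    ⟨fun z => Complex.exp (L z), by fun_prop⟩ (a₀ := x) (e₀ := L x) rfl
    (fun z => Complex.exp_ne_zero _)
  have heq := hlift.unique (y₁ := ⟨L, hL⟩) (y₂ := ⟨fun z => L' z + (L x - L' x), by fun_prop⟩)
    ⟨rfl, rfl⟩ ⟨add_sub_cancel _ _, funext hshift⟩
  have hy : L y = L' y + (L x - L' x) := DFunLike.congr_fun heq y
  rw [hy]
  ring

/-- `z` is the change of the complex logarithm along the curve `γ` from time `0` to time `1`; its
imaginary part is the angle swept around the origin. Stating it as a relation avoids a junk value
for curves through the origin. -/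
def HasLogIncrement (γ : ℝ → ℂ) (z : ℂ) : Prop :=
  ∃ L : ℝ → ℂ, Continuous L ∧ (∀ t, Complex.exp (L t) = γ t) ∧ L 1 - L 0 = z

theorem HasLogIncrement.unique {γ : ℝ → ℂ} {z w : ℂ} (hz : HasLogIncrement γ z)
    (hw : HasLogIncrement γ w) : z = w := by
  obtain ⟨L, hL, hexp, rfl⟩ := hz
  obtain ⟨L', hL', hexp', rfl⟩ := hw
  exact sub_eq_sub_of_exp_eq hL hL' (fun t => (hexp t).trans (hexp' t).symm) 0 1

theorem exists_hasLogIncrement {γ : ℝ → ℂ} (hγ : Continuous γ) (h0 : ∀ t, γ t ≠ 0) {z w : ℂ}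
    (hz : Complex.exp z = γ 0) (hw : Complex.exp w = γ 1) :
    ∃ k : ℤ, HasLogIncrement γ (w - z + k * (2 * Real.pi * Complex.I)) := by
  obtain ⟨L, hL, hexp⟩ := exists_continuous_log hγ h0
  obtain ⟨m, hm⟩ := Complex.exp_eq_exp_iff_exists_int.1 ((hexp 0).trans hz.symm)
  obtain ⟨n, hn⟩ := Complex.exp_eq_exp_iff_exists_int.1 ((hexp 1).trans hw.symm)
  refine ⟨n - m, L, hL, hexp, ?_⟩
  rw [hm, hn]
  push_cast
  ring

/-- For disjoint curves, `σ s - τ t` has a logarithm on the whole square of parameters `(s, t)`, and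
both sides compute its total change along the boundary. -/
theorem sub_eq_sub_of_hasLogIncrement {σ τ : ℝ → ℂ} (hσ : Continuous σ) (hτ : Continuous τ)
    (hne : ∀ s t, σ s ≠ τ t) {z₀ z₁ w₀ w₁ : ℂ} (hz₀ : HasLogIncrement (fun s => σ s - τ 0) z₀)
    (hz₁ : HasLogIncrement (fun s => σ s - τ 1) z₁)
    (hw₀ : HasLogIncrement (fun t => τ t - σ 0) w₀)
    (hw₁ : HasLogIncrement (fun t => τ t - σ 1) w₁) : z₁ - z₀ = w₁ - w₀ := by
  obtain ⟨L, hL, hexp⟩ := exists_continuous_log (X := ℝ × ℝ) (g := fun p => σ p.1 - τ p.2)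
    (by fun_prop) (fun p => sub_ne_zero.2 (hne _ _))
  have hσL : ∀ t, HasLogIncrement (fun s => σ s - τ t) (L (1, t) - L (0, t)) := fun t =>
    ⟨fun s => L (s, t), by fun_prop, fun s => hexp (s, t), rfl⟩
  have hτL : ∀ s, HasLogIncrement (fun t => τ t - σ s) (L (s, 1) - L (s, 0)) := fun s => by
    refine ⟨fun t => L (s, t) + Real.pi * Complex.I, by fun_prop, fun t => ?_, by ring⟩
    rw [Complex.exp_add, Complex.exp_pi_mul_I, hexp]
    ring
  rw [hz₀.unique (hσL 0), hz₁.unique (hσL 1), hw₀.unique (hτL 0), hw₁.unique (hτL 1)]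
  ring

section VanKampen

variable {ι : Type*} [LinearOrder ι] {pt : ι → ℂ} {u v : ι}

/-- A logarithm of `pt u - pt v`, chosen antisymmetrically up to the sign of the half-turn. -/
noncomputable def diffLog (pt : ι → ℂ) (u v : ι) : ℂ :=
  if u < v then Complex.log (pt u - pt v) else Complex.log (pt v - pt u) + Real.pi * Complex.I

/-- The half-turns, counted with sign, that lead from `diffLog pt u v` to `diffLog pt v u`. -/
def orderSign (u v : ι) : ℤ := if u < v then 1 else -1

theorem exp_diffLog (hpt : Function.Injective pt) (h : u ≠ v) :
    Complex.exp (diffLog pt u v) = pt u - pt v := by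
  unfold diffLog
  split_ifs
  · exact Complex.exp_log (sub_ne_zero.2 (hpt.ne h))
  · rw [Complex.exp_add, Complex.exp_pi_mul_I, Complex.exp_log (sub_ne_zero.2 (hpt.ne h.symm))]
    ring

theorem diffLog_swap (pt : ι → ℂ) (h : u ≠ v) :
    diffLog pt v u = diffLog pt u v + orderSign u v * (Real.pi * Complex.I) := by
  rcases lt_or_gt_of_ne h with h | h <;> simp [diffLog, orderSign, h, h.not_gt]

/-- The curves `γ i j` with `E i j` draw a graph so that edges without a common end do not meet.
Edges with a common end may cross, and an edge may cross itself. -/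
structure IsIndependentDrawing (E : ι → ι → Prop) (pt : ι → ℂ)
    (γ : ∀ i j, Path (pt i) (pt j)) : Prop where
  injective : Function.Injective pt
  disjoint : ∀ ⦃a b c d⦄, E a b → E c d → a ≠ c → a ≠ d → b ≠ c → b ≠ d →
    Disjoint (Set.range (γ a b)) (Set.range (γ c d))

/-- An integral form of the van Kampen obstruction. The right-hand side is `± 2` if the chords `ab`
and `cd` cross when the vertices are placed on a circle in their order, and `0` otherwise;
`N a b v` counts the full turns that the edge `ab` makes around `v` in excess of `diffLog`. -/
theorem IsIndependentDrawing.exists_crossing_cochain {E : ι → ι → Prop}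
    {γ : ∀ i j, Path (pt i) (pt j)} (hD : IsIndependentDrawing E pt γ) :
    ∃ N : ι → ι → ι → ℤ, ∀ a b c d, E a b → E c d → a ≠ c → a ≠ d → b ≠ c → b ≠ d →
      2 * (N a b d - N a b c - N c d b + N c d a) =
        orderSign b d - orderSign a d - orderSign b c + orderSign a c := by
  have hturns : ∀ a b v, ∃ k : ℤ, a ≠ v → b ≠ v → (∀ s, (γ a b).extend s ≠ pt v) →
      HasLogIncrement (fun s => (γ a b).extend s - pt v)
        (diffLog pt b v - diffLog pt a v + k * (2 * Real.pi * Complex.I)) := fun a b v => by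
    by_cases h : a ≠ v ∧ b ≠ v ∧ ∀ s, (γ a b).extend s ≠ pt v
    · obtain ⟨k, hk⟩ := exists_hasLogIncrement (γ := fun s => (γ a b).extend s - pt v)
        (by fun_prop) (fun s => sub_ne_zero.2 (h.2.2 s))
        (by simpa using exp_diffLog hD.injective h.1)
        (by simpa using exp_diffLog hD.injective h.2.1)
      exact ⟨k, fun _ _ _ => hk⟩
    · exact ⟨0, fun hav hbv hne => (h ⟨hav, hbv, hne⟩).elim⟩
  choose N hN using hturns
  refine ⟨N, fun a b c d hab hcd hac had hbc hbd => ?_⟩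
  have hne : ∀ s t, (γ a b).extend s ≠ (γ c d).extend t := fun s t =>
    (hD.disjoint hab hcd hac had hbc hbd).ne_of_mem ⟨_, rfl⟩ ⟨_, rfl⟩
  have hsquare := sub_eq_sub_of_hasLogIncrement (γ a b).continuous_extend
    (γ c d).continuous_extend hne
    (by simpa using hN a b c hac hbc fun s => by simpa using hne s 0)
    (by simpa using hN a b d had hbd fun s => by simpa using hne s 1)
    (by simpa using hN c d a hac.symm had.symm fun s => by simpa using (hne 0 s).symm)
    (by simpa using hN c d b hbc.symm hbd.symm fun s => by simpa using (hne 1 s).symm)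
  rw [diffLog_swap pt hbd, diffLog_swap pt hbc, diffLog_swap pt had, diffLog_swap pt hac]
    at hsquare
  have hpi : (Real.pi * Complex.I : ℂ) ≠ 0 := by simp [Real.pi_ne_zero]
  have hcancel : (Real.pi * Complex.I : ℂ) * (2 * (N a b d - N a b c - N c d b + N c d a)) =
      (Real.pi * Complex.I : ℂ) *
        (orderSign b d - orderSign a d - orderSign b c + orderSign a c) := by
    linear_combination hsquare
  exact_mod_cast mul_left_cancel₀ hpi hcancel

end VanKampen

/-- Add the van Kampen identities of the fifteen pairs of disjoint edges: each `N a b v` occurs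
twice, but five pairs of chords of a convex pentagon cross. -/
theorem not_isIndependentDrawing_completeGraph_five {pt : Fin 5 → ℂ}
    {γ : ∀ i j, Path (pt i) (pt j)} : ¬ IsIndependentDrawing (· < ·) pt γ := by
  intro hD
  obtain ⟨N, hN⟩ := hD.exists_crossing_cochain
  have h0123 := hN 0 1 2 3
  have h0124 := hN 0 1 2 4
  have h0134 := hN 0 1 3 4
  have h0213 := hN 0 2 1 3
  have h0214 := hN 0 2 1 4
  have h0234 := hN 0 2 3 4
  have h0312 := hN 0 3 1 2
  have h0314 := hN 0 3 1 4
  have h0324 := hN 0 3 2 4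
  have h0412 := hN 0 4 1 2
  have h0413 := hN 0 4 1 3
  have h0423 := hN 0 4 2 3
  have h1234 := hN 1 2 3 4
  have h1324 := hN 1 3 2 4
  have h1423 := hN 1 4 2 3
  simp [orderSign] at h0123 h0124 h0134 h0213 h0214 h0234 h0312 h0314
  simp [orderSign] at h0324 h0412 h0413 h0423 h1234 h1324 h1423
  omega

/-- As for the complete graph on five vertices: with the two sides in consecutive order, nine of the
eighteen pairs of disjoint edges cross. -/
theorem not_isIndependentDrawing_completeBipartiteGraph_three_three {pt : Fin 6 → ℂ}
    {γ : ∀ i j, Path (pt i) (pt j)} :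
    ¬ IsIndependentDrawing (fun i j => i < 3 ∧ 3 ≤ j) pt γ := by
  intro hD
  obtain ⟨N, hN⟩ := hD.exists_crossing_cochain
  have h0314 := hN 0 3 1 4
  have h0315 := hN 0 3 1 5
  have h0413 := hN 0 4 1 3
  have h0415 := hN 0 4 1 5
  have h0513 := hN 0 5 1 3
  have h0514 := hN 0 5 1 4
  have h0324 := hN 0 3 2 4
  have h0325 := hN 0 3 2 5
  have h0423 := hN 0 4 2 3
  have h0425 := hN 0 4 2 5
  have h0523 := hN 0 5 2 3
  have h0524 := hN 0 5 2 4
  have h1324 := hN 1 3 2 4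
  have h1325 := hN 1 3 2 5
  have h1423 := hN 1 4 2 3
  have h1425 := hN 1 4 2 5
  have h1523 := hN 1 5 2 3
  have h1524 := hN 1 5 2 4
  simp [orderSign] at h0314 h0315 h0413 h0415 h0513 h0514 h0324 h0325 h0423
  simp [orderSign] at h0425 h0523 h0524 h1324 h1325 h1423 h1425 h1523 h1524
  omega

section ReachableIn

variable {V : Type*} {G H : SimpleGraph V} {S T : Set V} {u v w : V}

/-- `u` and `v` are joined by a walk all of whose vertices, ends included, lie in `S`. -/
def ReachableIn (G : SimpleGraph V) (S : Set V) (u v : V) : Prop :=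
  ∃ p : G.Walk u v, ∀ w ∈ p.support, w ∈ S

namespace ReachableIn

theorem refl (hu : u ∈ S) : ReachableIn G S u u := ⟨.nil, by simpa using hu⟩

theorem symm : ReachableIn G S u v → ReachableIn G S v u :=
  fun ⟨p, hp⟩ => ⟨p.reverse, by simpa using hp⟩

theorem trans : ReachableIn G S u v → ReachableIn G S v w → ReachableIn G S u w :=
  fun ⟨p, hp⟩ ⟨q, hq⟩ =>
    ⟨p.append q, fun x hx =>
      ((SimpleGraph.Walk.mem_support_append_iff _ _).1 hx).elim (hp x) (hq x)⟩

theorem mem_left : ReachableIn G S u v → u ∈ S := fun ⟨p, hp⟩ => hp u p.start_mem_support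

theorem mem_right : ReachableIn G S u v → v ∈ S := fun ⟨p, hp⟩ => hp v p.end_mem_support

theorem of_adj (h : G.Adj u v) (hu : u ∈ S) (hv : v ∈ S) : ReachableIn G S u v :=
  ⟨h.toWalk, by simp [hu, hv]⟩

theorem cons (h : G.Adj u v) (hu : u ∈ S) (hvw : ReachableIn G S v w) : ReachableIn G S u w :=
  (of_adj h hu hvw.mem_left).trans hvw

@[elab_as_elim]
theorem head_induction {motive : ∀ x, ReachableIn G S x v → Prop}
    (refl : ∀ hv : v ∈ S, motive v (.refl hv))
    (cons : ∀ x y (hadj : G.Adj x y) (hx : x ∈ S) (hy : ReachableIn G S y v),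
      motive y hy → motive x (.cons hadj hx hy)) (h : ReachableIn G S u v) : motive u h := by
  obtain ⟨p, hp⟩ := h
  induction p with
  | nil => exact refl (hp _ (by simp))
  | cons hadj p ih =>
    have hp' : ∀ w ∈ p.support, w ∈ S := fun w hw => hp w (by simp [hw])
    exact cons _ _ hadj (hp _ (by simp)) ⟨p, hp'⟩ (ih refl cons hp')

theorem map {W : Type*} {H : SimpleGraph W} {T : Set W} {f : V → W} (h : ReachableIn G S u v)
    (hST : ∀ x ∈ S, f x ∈ T) (hGH : ∀ x ∈ S, ∀ y ∈ S, G.Adj x y → H.Adj (f x) (f y)) :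
    ReachableIn H T (f u) (f v) := by
  induction h using head_induction with
  | refl hv => exact refl (hST _ hv)
  | cons x y hadj hx hy ih => exact cons (hGH x hx y hy.mem_left hadj) (hST x hx) ih

theorem mono (h : ReachableIn G S u v) (hST : S ⊆ T)
    (hGH : ∀ x ∈ S, ∀ y ∈ S, G.Adj x y → H.Adj x y) : ReachableIn H T u v :=
  h.map (f := id) hST hGH

theorem mono_set (h : ReachableIn G S u v) (hST : S ⊆ T) : ReachableIn G T u v :=
  h.mono hST fun _ _ _ _ => id

theorem inter_of_invariant (h : ReachableIn G S u v) (hv : v ∈ T)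
    (hT : ∀ x ∈ S, ∀ y ∈ S, G.Adj x y → y ∈ T → x ∈ T) : ReachableIn G (S ∩ T) u v := by
  induction h using head_induction with
  | refl hS => exact refl ⟨hS, hv⟩
  | cons x y hadj hx hy ih => exact cons hadj ⟨hx, hT x hx y hy.mem_left hadj ih.mem_left.2⟩ ih

theorem eq_of_invariant {α : Type*} {f : V → α} (h : ReachableIn G S u v)
    (hf : ∀ x ∈ S, ∀ y ∈ S, G.Adj x y → f x = f y) : f u = f v := by
  induction h using head_induction with
  | refl => rfl
  | cons x y hadj hx hy ih => exact (hf x hx y hy.mem_left hadj).trans ih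

theorem exists_eq_of_le_of_le {f : V → ℕ} {r : ℕ} (h : ReachableIn G S u v)
    (hf : ∀ x ∈ S, ∀ y ∈ S, G.Adj x y → f y ≤ f x + 1) (hu : f u ≤ r) (hv : r ≤ f v) :
    ∃ w ∈ S, f w = r := by
  induction h using head_induction with
  | refl hS => exact ⟨v, hS, hu.antisymm hv⟩
  | cons x y hadj hx hy ih =>
    rcases hu.eq_or_lt with hxr | hxr
    · exact ⟨x, hx, hxr⟩
    · exact ih ((hf x hx y hy.mem_left hadj).trans hxr)

end ReachableIn

end ReachableIn

section Drawing

variable {V : Type*} {G : SimpleGraph V} {S T : Set V} {u v : V}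

/-- `point` and `arc` are the vertices and edges of a drawing of `G` witnessing `IsPlanar G`. -/
structure IsDrawing (G : SimpleGraph V) (point : V → Plane) (arc : Sym2 V → Set Plane) :
    Prop where
  injective : Function.Injective point
  isArc : ∀ u v, G.Adj u v → IsArc (arc s(u, v)) (point u) (point v)
  mem_of_point_mem : ∀ e ∈ G.edgeSet, ∀ w, point w ∈ arc e → w ∈ e
  exists_point_of_mem : ∀ e ∈ G.edgeSet, ∀ e' ∈ G.edgeSet, e ≠ e' →
    ∀ x ∈ arc e ∩ arc e', ∃ w, w ∈ e ∧ w ∈ e' ∧ x = point w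

/-- The part of the plane occupied by the subgraph of `G` induced by `S`. -/
def drawn (G : SimpleGraph V) (point : V → Plane) (arc : Sym2 V → Set Plane) (S : Set V) :
    Set Plane :=
  point '' S ∪ ⋃ e ∈ {e ∈ G.edgeSet | ∀ w ∈ e, w ∈ S}, arc e

variable {point : V → Plane} {arc : Sym2 V → Set Plane}

theorem IsDrawing.disjoint_drawn (hG : IsDrawing G point arc) (hST : Disjoint S T) :
    Disjoint (drawn G point arc S) (drawn G point arc T) := by
  have hne : ∀ e : Sym2 V, (∀ w ∈ e, w ∈ S) → ¬ ∀ w ∈ e, w ∈ T := fun e =>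
    e.ind fun u v hS hT => Set.disjoint_left.1 hST (hS u (by simp)) (hT u (by simp))
  rw [Set.disjoint_left]
  simp only [drawn, Set.mem_union, Set.mem_image, Set.mem_iUnion, Set.mem_sep_iff]
  rintro x (⟨u, hu, rfl⟩ | ⟨e, ⟨he, heS⟩, hxe⟩) (⟨v, hv, hvx⟩ | ⟨e', ⟨he', heT⟩, hxe'⟩)
  · exact hST.ne_of_mem hu hv (hG.injective hvx).symm
  · exact Set.disjoint_left.1 hST hu (heT u (hG.mem_of_point_mem e' he' u hxe'))
  · subst hvx
    exact Set.disjoint_left.1 hST (heS v (hG.mem_of_point_mem e he v hxe)) hv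
  · obtain ⟨w, hwe, hwe', -⟩ := hG.exists_point_of_mem e he e' he'
      (fun h => hne e heS (h ▸ heT)) x ⟨hxe, hxe'⟩
    exact Set.disjoint_left.1 hST (heS w hwe) (heT w hwe')

theorem IsDrawing.joinedIn_drawn (hG : IsDrawing G point arc) (h : ReachableIn G S u v) :
    JoinedIn (drawn G point arc S) (point u) (point v) := by
  induction h using ReachableIn.head_induction with
  | refl hv => exact JoinedIn.refl (Or.inl ⟨v, hv, rfl⟩)
  | cons x y hadj hx hy ih =>
    obtain ⟨γ, -, hγ⟩ := hG.isArc x y hadj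
    have hxy : s(x, y) ∈ {e ∈ G.edgeSet | ∀ w ∈ e, w ∈ S} := ⟨hadj, by simp [hx, hy.mem_left]⟩
    exact JoinedIn.trans
      ⟨γ, fun t => Or.inr (Set.mem_biUnion hxy (hγ ▸ Set.mem_range_self t))⟩ ih

end Drawing

section Model

variable {V ι : Type*} {G : SimpleGraph V} {E : ι → ι → Prop} {B : ι → Set V} {b : ι → V}

/-- Disjoint vertex sets `B i` with marked vertices `b i`, such that `b i` and `b j` are joined
inside `B i ∪ B j` whenever `E i j`. This is weaker than a minor model with branch sets `B i`, as
`B i` need not be connected. -/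
structure IsModel (G : SimpleGraph V) (E : ι → ι → Prop) (B : ι → Set V) (b : ι → V) : Prop where
  mem : ∀ i, b i ∈ B i
  disjoint : Pairwise fun i j => Disjoint (B i) (B j)
  reach : ∀ i j, E i j → ReachableIn G (B i ∪ B j) (b i) (b j)

theorem IsPlanar.exists_isIndependentDrawing (hG : IsPlanar G) (hM : IsModel G E B b) :
    ∃ (pt : ι → ℂ) (γ : ∀ i j, Path (pt i) (pt j)), IsIndependentDrawing E pt γ := by
  obtain ⟨point, arc, hinj, harc, hmem, hmeet⟩ := hG
  have hG : IsDrawing G point arc := ⟨hinj, harc, hmem, hmeet⟩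
  let φ := Complex.orthonormalBasisOneI.repr.symm
  have hγ : ∀ i j, ∃ γ : Path (point (b i)) (point (b j)),
      E i j → ∀ t, γ t ∈ drawn G point arc (B i ∪ B j) := fun i j => by
    by_cases hE : E i j
    · obtain ⟨γ, hγ⟩ := hG.joinedIn_drawn (hM.reach i j hE)
      exact ⟨γ, fun _ => hγ⟩
    · exact ⟨PathConnectedSpace.somePath _ _, fun h => (hE h).elim⟩
  choose γ hγ using hγ
  refine ⟨fun i => φ (point (b i)), fun i j => (γ i j).map φ.continuous, fun i j hij => ?_,
    fun i j k l hij hkl hik hil hjk hjl => ?_⟩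
  · by_contra hne
    exact (hM.disjoint hne).ne_of_mem (hM.mem i) (hM.mem j) (hG.injective (φ.injective hij))
  · rw [Set.disjoint_left]
    rintro _ ⟨s, rfl⟩ ⟨t, hst⟩
    have hdisj : Disjoint (B i ∪ B j) (B k ∪ B l) := by
      simp only [Set.disjoint_union_left, Set.disjoint_union_right]
      exact ⟨⟨hM.disjoint hik, hM.disjoint hjk⟩, hM.disjoint hil, hM.disjoint hjl⟩
    exact (hG.disjoint_drawn hdisj).ne_of_mem (hγ i j hij s) (hγ k l hkl t)
      (φ.injective hst.symm)

theorem IsPlanar.not_isModel_completeGraph_five (hG : IsPlanar G)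
    {B : Fin 5 → Set V} {b : Fin 5 → V} : ¬ IsModel G (· < ·) B b := fun hM =>
  let ⟨_, _, hD⟩ := hG.exists_isIndependentDrawing hM
  not_isIndependentDrawing_completeGraph_five hD

theorem IsPlanar.not_isModel_completeBipartiteGraph_three_three (hG : IsPlanar G)
    {B : Fin 6 → Set V} {b : Fin 6 → V} :
    ¬ IsModel G (fun i j => i < 3 ∧ 3 ≤ j) B b := fun hM =>
  let ⟨_, _, hD⟩ := hG.exists_isIndependentDrawing hM
  not_isIndependentDrawing_completeBipartiteGraph_three_three hD

end Model

section Chordal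

variable {V : Type*} {G : SimpleGraph V} {S A B : Set V} {u v : V}

/-- The vertices `p 0, …, p k` form an induced path of `G`. -/
def IsInducedPath (G : SimpleGraph V) (p : ℕ → V) (k : ℕ) : Prop :=
  ∀ ⦃i j⦄, i < j → j ≤ k → p i ≠ p j ∧ (G.Adj (p i) (p j) ↔ j = i + 1)

theorem ReachableIn.exists_isInducedPath (h : ReachableIn G S u v) :
    ∃ p k, p 0 = u ∧ p k = v ∧ (∀ i, p i ∈ S) ∧ IsInducedPath G p k := by
  obtain ⟨w, hw⟩ := h
  obtain ⟨p, hp⟩ := (w.induce S hw).reachable.exists_walk_length_eq_dist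
  refine ⟨fun i => p.getVert i, p.length, by simp, by simp, fun i => (p.getVert i).2,
    fun i j hij hj => ?_⟩
  have hlen : ∀ r : (G.induce S).Walk (p.getVert i) (p.getVert j), j ≤ i + r.length := fun r => by
    have := SimpleGraph.dist_le ((p.take i).append (r.append (p.drop j)))
    simp only [SimpleGraph.Walk.length_append, SimpleGraph.Walk.take_length,
      SimpleGraph.Walk.drop_length] at this
    omega
  refine ⟨fun heq => ?_, fun hadj => ?_, ?_⟩
  · have := hlen (SimpleGraph.Walk.nil.copy rfl (Subtype.ext heq))
    simp only [SimpleGraph.Walk.length_copy, SimpleGraph.Walk.length_nil] at this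
    omega
  · have := hlen (SimpleGraph.Adj.toWalk (SimpleGraph.comap_adj.2 hadj))
    simp only [SimpleGraph.Walk.length_cons, SimpleGraph.Walk.length_nil] at this
    omega
  · rintro rfl
    exact p.adj_getVert_succ hj

theorem cycleGraph_adj_iff_of_lt {n : ℕ} {i j : Fin n} (h : i < j) :
    (SimpleGraph.cycleGraph n).Adj i j ↔
      (j : ℕ) = i + 1 ∨ (i : ℕ) = 0 ∧ (j : ℕ) + 1 = n := by
  rw [SimpleGraph.cycleGraph_adj', Fin.coe_sub_iff_lt.2 h, Fin.coe_sub_iff_le.2 h.le]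
  omega

theorem IsChordal.not_inducedCycle (hG : IsChordal G) {n : ℕ} (hn : 4 ≤ n) {f : ℕ → V} :
    ¬ ∀ i j, i < j → j < n →
      f i ≠ f j ∧ (G.Adj (f i) (f j) ↔ j = i + 1 ∨ i = 0 ∧ j + 1 = n) := by
  intro hf
  have hiff : ∀ i j : Fin n, i < j →
      (G.Adj (f i) (f j) ↔ (SimpleGraph.cycleGraph n).Adj i j) := fun i j hij => by
    rw [(hf i j hij j.2).2, cycleGraph_adj_iff_of_lt hij]
  refine (hG n hn).false ⟨⟨fun i : Fin n => f i, fun i j hij => ?_⟩, fun {i j} => ?_⟩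
  · by_contra hij'
    rcases lt_or_gt_of_ne hij' with h | h
    · exact (hf i j h j.2).1 hij
    · exact (hf j i h i.2).1 hij.symm
  · rcases lt_trichotomy i j with h | rfl | h
    · exact hiff i j h
    · simp
    · rw [G.adj_comm, SimpleGraph.adj_comm _ i]
      exact hiff j i h

theorem IsChordal.exists_eq_or_adj_of_isInducedPath (hG : IsChordal G) {p q : ℕ → V} {k l : ℕ}
    (hp : IsInducedPath G p k) (hq : IsInducedPath G q l) (h₀ : q 0 = p 0) (hl : q l = p k)
    (hk2 : 2 ≤ k) (hl2 : 2 ≤ l) :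
    ∃ i j, 0 < i ∧ i < k ∧ 0 < j ∧ j < l ∧ (p i = q j ∨ G.Adj (p i) (q j)) := by
  by_contra! hpq
  refine hG.not_inducedCycle (n := k + l) (f := fun i => if i ≤ k then p i else q (k + l - i))
    (by omega) fun i j hij hjn => ?_
  by_cases hjk : j ≤ k
  · rw [if_pos (hij.le.trans hjk), if_pos hjk, (hp hij hjk).2]
    exact ⟨(hp hij hjk).1, by omega⟩
  rw [if_neg hjk]
  by_cases hik : i ≤ k
  · rw [if_pos hik]
    rcases Nat.eq_zero_or_pos i with rfl | hi
    · have := hq (i := 0) (j := k + l - j) (by omega) (by omega)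
      rw [← h₀, this.2]
      exact ⟨this.1, by omega⟩
    rcases hik.eq_or_lt with rfl | hik
    · have := hq (i := i + l - j) (j := l) (by omega) le_rfl
      rw [← hl, G.adj_comm, this.2]
      exact ⟨this.1.symm, by omega⟩
    · have := hpq i (k + l - j) hi hik (by omega) (by omega)
      exact ⟨this.1, iff_of_false this.2 (by omega)⟩
  · have := hq (i := k + l - j) (j := k + l - i) (by omega) (by omega)
    rw [if_neg hik, G.adj_comm, this.2]
    exact ⟨this.1.symm, by omega⟩

theorem IsInducedPath.mem_of_pos_of_lt {p : ℕ → V} {k i : ℕ} (hp : IsInducedPath G p k)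
    (hS : ∀ i, p i ∈ insert (p 0) (insert (p k) S)) (hi : 0 < i) (hik : i < k) : p i ∈ S :=
  ((hS i).resolve_left (hp hi hik.le).1.symm).resolve_left (hp hik le_rfl).1

theorem IsInducedPath.two_le {p : ℕ → V} {k : ℕ} (hp : IsInducedPath G p k) (hne : p 0 ≠ p k)
    (hadj : ¬ G.Adj (p 0) (p k)) : 2 ≤ k := by
  by_contra! hk
  interval_cases k
  · exact hne rfl
  · exact hadj ((hp zero_lt_one le_rfl).2.2 rfl)

/-- Otherwise shortest paths through `A` and through `B` would form an induced cycle. -/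
theorem IsChordal.adj_of_reachableIn (hG : IsChordal G) (huv : u ≠ v)
    (hAB : ∀ a ∈ A, ∀ b ∈ B, a ≠ b ∧ ¬ G.Adj a b)
    (hA : ReachableIn G (insert u (insert v A)) u v)
    (hB : ReachableIn G (insert u (insert v B)) u v) : G.Adj u v := by
  by_contra hadj
  obtain ⟨p, k, rfl, rfl, hpA, hp⟩ := hA.exists_isInducedPath
  obtain ⟨q, l, h₀, hl, hqB, hq⟩ := hB.exists_isInducedPath
  obtain ⟨i, j, hi, hik, hj, hjl, hij⟩ := hG.exists_eq_or_adj_of_isInducedPath hp hq h₀ hl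
    (hp.two_le huv hadj) (hq.two_le (h₀ ▸ hl ▸ huv) (h₀ ▸ hl ▸ hadj))
  rw [← h₀, ← hl] at hqB
  have := hAB _ (hp.mem_of_pos_of_lt hpA hi hik) _ (hq.mem_of_pos_of_lt hqB hj hjl)
  exact hij.elim this.1 this.2

end Chordal

section Layering

variable {V : Type*} {G : SimpleGraph V} {S : Set V} {level : V → ℕ} {root : V → V} {u v : V}

/-- A rooted layering of `G`: every component has one root, which is its only vertex of level `0`,
and the levels behave like distances from the roots. -/
structure IsLayering (G : SimpleGraph V) (level : V → ℕ) (root : V → V) : Prop where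
  level_le : ∀ ⦃u v⦄, G.Adj u v → level v ≤ level u + 1
  root_eq : ∀ ⦃u v⦄, G.Adj u v → root u = root v
  eq_root : ∀ ⦃v⦄, level v = 0 → root v = v
  exists_parent : ∀ ⦃v⦄, level v ≠ 0 → ∃ w, G.Adj v w ∧ level w + 1 = level v

theorem isLayering_dist (hr : ∀ v, G.Reachable (root v) v)
    (hadj : ∀ ⦃u v⦄, G.Adj u v → root u = root v) :
    IsLayering G (fun v => G.dist (root v) v) root where
  level_le u v huv := by
    rw [← hadj huv, ← SimpleGraph.dist_eq_one_iff_adj.2 huv]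
    exact (hr u).dist_triangle_left v
  root_eq := hadj
  eq_root v hv := (hr v).dist_eq_zero_iff.1 hv
  exists_parent v hv := by
    obtain ⟨p, hp⟩ := (hr v).symm.exists_walk_length_eq_dist
    have hnil : ¬ p.Nil := fun h => hv (by
      rw [SimpleGraph.dist_comm, ← hp, SimpleGraph.Walk.length_eq_zero_iff.2 h])
    have hsnd := p.adj_snd hnil
    refine ⟨p.snd, hsnd, ?_⟩
    have hle : G.dist (root v) p.snd ≤ p.tail.length := by
      rw [SimpleGraph.dist_comm]
      exact SimpleGraph.dist_le _
    have hge : G.dist (root v) v ≤ G.dist (root v) p.snd + G.dist p.snd v :=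
      ((hr v).trans hsnd.reachable).dist_triangle_left v
    rw [SimpleGraph.dist_eq_one_iff_adj.2 hsnd.symm] at hge
    rw [← hadj hsnd]
    have := SimpleGraph.Walk.length_tail_add_one hnil
    rw [SimpleGraph.dist_comm] at hp
    omega

theorem exists_isLayering (G : SimpleGraph V) : ∃ level root, IsLayering G level root :=
  ⟨_, _, isLayering_dist (root := fun v => (G.connectedComponentMk v).out)
    (fun _ => SimpleGraph.ConnectedComponent.exact (Quot.out_eq _))
    (fun _ _ h => by rw [SimpleGraph.ConnectedComponent.sound h.reachable])⟩

namespace IsLayering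

theorem root_eq_of_reachableIn (h : IsLayering G level root) (huv : ReachableIn G S u v) :
    root u = root v :=
  huv.eq_of_invariant fun _ _ _ _ hadj => h.root_eq hadj

theorem reachableIn_root (h : IsLayering G level root) (v : V) :
    ReachableIn G (insert v {w | level w < level v}) v (root v) := by
  induction hv : level v generalizing v with
  | zero =>
    rw [h.eq_root hv]
    exact .refl (Set.mem_insert _ _)
  | succ n ih =>
    obtain ⟨w, hvw, hw⟩ := h.exists_parent (hv.trans_ne n.succ_ne_zero)
    have hwn : level w = n := by omega
    rw [h.root_eq hvw]
    refine .cons hvw (Set.mem_insert _ _) ((ih w hwn).mono_set ?_)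
    rintro x (rfl | hx)
    · exact Or.inr (hwn.trans_lt n.lt_succ_self)
    · exact Or.inr (Nat.lt_succ_of_lt hx)

theorem level_root (h : IsLayering G level root) (v : V) : level (root v) = 0 := by
  induction hv : level v generalizing v with
  | zero => rw [h.eq_root hv, hv]
  | succ n ih =>
    obtain ⟨w, hvw, hw⟩ := h.exists_parent (hv.trans_ne n.succ_ne_zero)
    rw [h.root_eq hvw]
    exact ih w (by omega)

theorem pos_of_adj (h : IsLayering G level root) (huv : G.Adj u v) (hl : level u = level v) :
    0 < level u := by
  by_contra! h0
  refine huv.ne ?_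
  rw [← h.eq_root (v := u) (by omega), ← h.eq_root (v := v) (by omega), h.root_eq huv]

theorem eq_or_adj_of_reachableIn (h : IsLayering G level root) (hG : IsChordal G) {u' v' : V}
    (huv : level u = level v) (hu : G.Adj u u') (hv : G.Adj v v')
    (hr : ReachableIn G {w | level u < level w} u' v') : u = v ∨ G.Adj u v := by
  by_contra! hne
  refine hne.2 (hG.adj_of_reachableIn (A := {w | level u < level w}) (B := {w | level w < level u})
    hne.1 ?_ ?_ ?_)
  · intro a ha b hb
    simp only [Set.mem_ofPred_eq] at ha hb
    refine ⟨fun hab => by subst hab; omega, fun hab => ?_⟩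
    have := h.level_le hab.symm
    omega
  · refine .cons hu (by simp) (.symm (.cons hv (by simp) (hr.symm.mono_set ?_)))
    exact (Set.subset_insert _ _).trans (Set.subset_insert _ _)
  · have hroot : root u = root v := (h.root_eq hu).trans
      ((h.root_eq_of_reachableIn hr).trans (h.root_eq hv).symm)
    have hu' := (h.reachableIn_root u).mono_set
      (Set.insert_subset_insert (Set.subset_insert v {w | level w < level u}))
    have hv' := h.reachableIn_root v
    rw [← huv, ← hroot] at hv'
    exact hu'.trans (hv'.mono_set (Set.subset_insert _ _)).symm

end IsLayering

/-- The edges of `G` along which `f` does not change. -/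
def sameLayer {α : Type*} (G : SimpleGraph V) (f : V → α) : SimpleGraph V where
  Adj u v := G.Adj u v ∧ f u = f v
  symm := ⟨fun _ _ h => ⟨h.1.symm, h.2.symm⟩⟩
  loopless := ⟨fun _ h => h.1.ne rfl⟩

theorem IsChordal.sameLayer (hG : IsChordal G) {α : Type*} (f : V → α) :
    IsChordal (sameLayer G f) := by
  refine fun n hn => ⟨fun e => (hG n hn).false ⟨e.toEmbedding, fun {i j} => ?_⟩⟩
  have hconst : f (e i) = f (e j) := by
    obtain ⟨p⟩ := SimpleGraph.cycleGraph_preconnected i j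
    induction p with
    | nil => rfl
    | cons hadj _ ih => exact (e.map_rel_iff.2 hadj).2.trans ih
  exact ⟨fun hadj => e.map_rel_iff.1 ⟨hadj, hconst⟩, fun hadj => (e.map_rel_iff.2 hadj).1⟩

/-- An excursion above the layer leaves and enters it at equal or adjacent vertices. -/
theorem IsLayering.reachableIn_sameLayer (h : IsLayering G level root) (hG : IsChordal G)
    (hS : ∀ w ∈ S, level v ≤ level w) (huv : level u = level v) (hr : ReachableIn G S u v) :
    ReachableIn (sameLayer G level) S u v := by
  suffices h' : (level u = level v → ReachableIn (sameLayer G level) S u v) ∧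
      (level v < level u → ∀ x y, x ∈ S → level x = level v → G.Adj x y →
        ReachableIn G {w | level v < level w} y u → ReachableIn (sameLayer G level) S x v) from
    h'.1 huv
  clear huv
  induction hr using ReachableIn.head_induction with
  | refl hv => exact ⟨fun _ => .refl hv, fun hlt => (lt_irrefl _ hlt).elim⟩
  | cons x y hxy hx hy ih =>
    rcases (hS y hy.mem_left).eq_or_lt with hyv | hyv
    · refine ⟨fun hxv => .cons ⟨hxy, hxv.trans hyv⟩ hx (ih.1 hyv.symm),
        fun _ z z' hz hzv hzz' hz' => ?_⟩
      rcases h.eq_or_adj_of_reachableIn hG (hzv.trans hyv) hzz' hxy.symm (hzv ▸ hz') with rfl | hzy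
      · exact ih.1 hzv
      · exact .cons ⟨hzy, hzv.trans hyv⟩ hz (ih.1 hyv.symm)
    · refine ⟨fun hxv => ih.2 hyv x y hx hxv hxy (.refl hyv),
        fun hxv z z' hz hzv hzz' hz' => ih.2 hyv z z' hz hzv hzz' ?_⟩
      exact hz'.trans (.of_adj hxy hxv hyv)

end Layering

section Hub

variable {V : Type*} {G : SimpleGraph V} {A B X Y : Set V} {a b c x y z : V}

/-- All vertices of `X` can be joined to the hub `a` inside the set `A`, which avoids `X`. After
contracting `A` one would see a vertex adjacent to all of `X`. -/
structure IsHub (G : SimpleGraph V) (A : Set V) (a : V) (X : Set V) : Prop where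
  mem : a ∈ A
  notMem : ∀ v ∈ X, v ∉ A
  reach : ∀ v ∈ X, ReachableIn G (insert v A) v a

theorem IsHub.mono (h : IsHub G A a X) (hYX : Y ⊆ X) : IsHub G A a Y :=
  ⟨h.mem, fun v hv => h.notMem v (hYX hv), fun v hv => h.reach v (hYX hv)⟩

theorem IsHub.of_sameLayer {α : Type*} {f : V → α} (h : IsHub (sameLayer G f) A a X)
    (hx : x ∈ X) :
    IsHub G (A ∩ {w | f w = f x}) a (X ∩ {w | f w = f x}) where
  mem := ⟨h.mem, ((h.reach x hx).eq_of_invariant fun _ _ _ _ hadj => hadj.2).symm⟩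
  notMem v hv hA := h.notMem v hv.1 hA.1
  reach v hv := by
    have hr : ReachableIn (sameLayer G f) (insert v A ∩ {w | f w = f x}) v a :=
      ((h.reach v hv.1).symm.inter_of_invariant hv.2 fun u _ w _ hadj hw => hadj.2.trans hw).symm
    refine hr.mono ?_ fun _ _ _ _ hadj => hadj.1
    rintro w ⟨rfl | hw, hwx⟩
    · exact Set.mem_insert _ _
    · exact Or.inr ⟨hw, hwx⟩

theorem IsPlanar.not_adj_of_isHub (hG : IsPlanar G) (hA : IsHub G A a X) (hB : IsHub G B b X)
    (hAB : Disjoint A B) (hab : ReachableIn G (A ∪ B) a b) (hx : x ∈ X) (hy : y ∈ X) (hz : z ∈ X)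
    (hxy : G.Adj x y) (hxz : G.Adj x z) : ¬ G.Adj y z := by
  intro hyz
  have hpair : ∀ {u v}, G.Adj u v → ReachableIn G ({u} ∪ {v}) u v := fun h =>
    .of_adj h (Or.inl rfl) (Or.inr rfl)
  refine hG.not_isModel_completeGraph_five (B := ![{x}, {y}, {z}, A, B]) (b := ![x, y, z, a, b])
    ⟨?_, ?_, ?_⟩
  · simp [Fin.forall_fin_succ, hA.mem, hB.mem]
  · simp [Pairwise, Fin.forall_fin_succ, hxy.ne, hxy.ne', hxz.ne, hxz.ne', hyz.ne, hyz.ne', hAB,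
      hAB.symm, hA.notMem _ hx, hA.notMem _ hy, hA.notMem _ hz, hB.notMem _ hx, hB.notMem _ hy,
      hB.notMem _ hz]
  · have hA' := hA.reach
    have hB' := hB.reach
    simp only [Set.insert_eq] at hA' hB'
    simp [Fin.forall_fin_succ, hpair hxy, hpair hxz, hpair hyz, hab, hA' _ hx, hA' _ hy, hA' _ hz,
      hB' _ hx, hB' _ hy, hB' _ hz, -Set.singleton_union, -Set.union_singleton]

theorem IsPlanar.eq_or_eq_or_eq_of_isHub (hG : IsPlanar G) (hA : IsHub G A a X)
    (hB : IsHub G B b X) (hAB : Disjoint A B) (hc : c ∈ X) (hx : x ∈ X) (hy : y ∈ X) (hz : z ∈ X)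
    (hcx : G.Adj c x) (hcy : G.Adj c y) (hcz : G.Adj c z) : x = y ∨ x = z ∨ y = z := by
  by_contra! hne
  obtain ⟨hxy, hxz, hyz⟩ := hne
  have hpair : ∀ {u v}, G.Adj u v → ReachableIn G ({u} ∪ {v}) u v := fun h =>
    .of_adj h (Or.inl rfl) (Or.inr rfl)
  refine hG.not_isModel_completeBipartiteGraph_three_three (B := ![{c}, A, B, {x}, {y}, {z}])
    (b := ![c, a, b, x, y, z]) ⟨?_, ?_, ?_⟩
  · simp [Fin.forall_fin_succ, hA.mem, hB.mem]
  · simp [Pairwise, Fin.forall_fin_succ, hcx.ne, hcx.ne', hcy.ne, hcy.ne', hcz.ne, hcz.ne', hxy,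
      hxy.symm, hxz, hxz.symm, hyz, hyz.symm, hAB, hAB.symm, hA.notMem _ hc, hA.notMem _ hx,
      hA.notMem _ hy, hA.notMem _ hz, hB.notMem _ hc, hB.notMem _ hx, hB.notMem _ hy,
      hB.notMem _ hz]
  · have hA' : ∀ v ∈ X, ReachableIn G (A ∪ {v}) a v := fun v hv => by
      simpa only [Set.union_singleton] using (hA.reach v hv).symm
    have hB' : ∀ v ∈ X, ReachableIn G (B ∪ {v}) b v := fun v hv => by
      simpa only [Set.union_singleton] using (hB.reach v hv).symm
    simp [Fin.forall_fin_succ, hpair hcx, hpair hcy, hpair hcz, hA' _ hx, hA' _ hy, hA' _ hz,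
      hB' _ hx, hB' _ hy, hB' _ hz, -Set.singleton_union, -Set.union_singleton]

variable {level level' : V → ℕ} {root root' : V → V}

theorem IsLayering.isHub (h : IsLayering G level root) (hx : 0 < level x) :
    IsHub G {w | level w < level x} (root x) {v | level v = level x ∧ root v = root x} where
  mem := (h.level_root x).trans_lt hx
  notMem _ hv := hv.1.not_lt
  reach v hv := by
    have := h.reachableIn_root v
    rwa [hv.1, hv.2] at this

/-- The two hubs are the root of the outer layering and the root of the inner one. -/
theorem IsLayering.exists_isHub_isHub (h : IsLayering G level root)
    (h' : IsLayering (sameLayer G level) level' root')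
    (hxy : (sameLayer (sameLayer G level) level').Adj x y) :
    ∃ A B a b, IsHub G A a (insert x ((sameLayer (sameLayer G level) level').neighborSet x)) ∧
      IsHub G B b (insert x ((sameLayer (sameLayer G level) level').neighborSet x)) ∧
      Disjoint A B ∧ ReachableIn G (A ∪ B) a b := by
  have hA := h.isHub (h.pos_of_adj hxy.1.1 hxy.1.2)
  have hB := (h'.isHub (h'.pos_of_adj hxy.1 hxy.2)).of_sameLayer (x := x) ⟨rfl, rfl⟩
  refine ⟨_, _, _, _, hA.mono ?_, hB.mono ?_, ?_, ?_⟩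
  · rintro v (rfl | hv)
    · exact ⟨rfl, rfl⟩
    · exact ⟨hv.1.2.symm, (h.root_eq hv.1.1).symm⟩
  · rintro v (rfl | hv)
    · exact ⟨⟨rfl, rfl⟩, rfl⟩
    · exact ⟨⟨hv.2.symm, (h'.root_eq hv.1).symm⟩, hv.1.2.symm⟩
  · rw [Set.disjoint_left]
    exact fun w hlt hw => hlt.ne hw.2
  · have hroot : root (root' x) = root x :=
      (h.root_eq_of_reachableIn (hB.reach x ⟨⟨rfl, rfl⟩, rfl⟩)).symm
    refine ((hA.reach (root' x) ⟨hB.mem.2, hroot⟩).mono_set ?_).symm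
    exact Set.insert_subset (Or.inr hB.mem) Set.subset_union_left

theorem IsPlanar.not_adj_sameLayer_sameLayer (hG : IsPlanar G) (h : IsLayering G level root)
    (h' : IsLayering (sameLayer G level) level' root')
    (hxy : (sameLayer (sameLayer G level) level').Adj x y)
    (hxz : (sameLayer (sameLayer G level) level').Adj x z) :
    ¬ (sameLayer (sameLayer G level) level').Adj y z := by
  obtain ⟨A, B, a, b, hA, hB, hAB, hab⟩ := h.exists_isHub_isHub h' hxy
  exact fun hyz => hG.not_adj_of_isHub hA hB hAB hab (Or.inl rfl) (Or.inr hxy) (Or.inr hxz)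
    hxy.1.1 hxz.1.1 hyz.1.1

theorem IsPlanar.eq_or_eq_or_eq_of_adj_sameLayer_sameLayer (hG : IsPlanar G)
    (h : IsLayering G level root) (h' : IsLayering (sameLayer G level) level' root')
    (hx : (sameLayer (sameLayer G level) level').Adj c x)
    (hy : (sameLayer (sameLayer G level) level').Adj c y)
    (hz : (sameLayer (sameLayer G level) level').Adj c z) : x = y ∨ x = z ∨ y = z := by
  obtain ⟨A, B, a, b, hA, hB, hAB, -⟩ := h.exists_isHub_isHub h' hx
  exact hG.eq_or_eq_or_eq_of_isHub hA hB hAB (Or.inl rfl) (Or.inr hx) (Or.inr hy) (Or.inr hz)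
    hx.1.1 hy.1.1 hz.1.1

end Hub

section LinearForest

variable {V : Type*} {K : SimpleGraph V} {S : Set V} {level f : V → ℕ} {root : V → V} {u v x y : V}

theorem IsLayering.level_ne_of_adj (h : IsLayering K level root) (hK : IsChordal K)
    (htri : ∀ ⦃x y z⦄, K.Adj x y → K.Adj x z → ¬ K.Adj y z) (huv : K.Adj u v) :
    level u ≠ level v := by
  intro heq
  have hpos := h.pos_of_adj huv heq
  obtain ⟨p, hup, hp⟩ := h.exists_parent (v := u) (by omega)
  obtain ⟨q, hvq, hq⟩ := h.exists_parent (v := v) (by omega)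
  have huv' : ReachableIn K {w | level p < level w} u v :=
    .of_adj huv (by simp only [Set.mem_ofPred_eq]; omega) (by simp only [Set.mem_ofPred_eq]; omega)
  rcases h.eq_or_adj_of_reachableIn hK (by omega) hup.symm hvq.symm huv' with rfl | hpq
  · exact htri huv hup hvq
  · have hpv : p ≠ v := fun hpv => by subst hpv; omega
    have hanti : ∀ a ∈ ({u} : Set V), ∀ b ∈ ({q} : Set V), a ≠ b ∧ ¬ K.Adj a b := by
      rintro _ rfl _ rfl
      exact ⟨fun huq => by subst huq; omega, fun huq => htri hup huq hpq⟩
    refine htri hup huv (hK.adj_of_reachableIn hpv hanti ?_ ?_)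
    · exact .cons hup.symm (by simp) (.of_adj huv (by simp) (by simp))
    · exact .cons hpq (by simp) (.of_adj hvq.symm (by simp) (by simp))

theorem IsLayering.eq_of_adj_of_level_lt (h : IsLayering K level root) (hK : IsChordal K)
    (htri : ∀ ⦃x y z⦄, K.Adj x y → K.Adj x z → ¬ K.Adj y z) (hx : K.Adj v x) (hy : K.Adj v y)
    (hxv : level x < level v) (hyv : level y < level v) : x = y := by
  have hx' := h.level_le hx.symm
  have hy' := h.level_le hy.symm
  exact (h.eq_or_adj_of_reachableIn hK (by omega) hx.symm hy.symm (.refl hxv)).resolve_right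
    (htri hx hy)

/-- A vertex furthest from the root of its component is a leaf. -/
theorem IsChordal.exists_leaf [Finite V] (hK : IsChordal K)
    (htri : ∀ ⦃x y z⦄, K.Adj x y → K.Adj x z → ¬ K.Adj y z) (r : V) :
    ∃ v, K.Reachable r v ∧ ∀ x y, K.Adj v x → K.Adj v y → x = y := by
  obtain ⟨level, root, h⟩ := exists_isLayering K
  obtain ⟨v, hv, hmax⟩ := Set.exists_max_image {v | K.Reachable r v} level (Set.toFinite _)
    ⟨r, SimpleGraph.Reachable.refl r⟩
  have hlt : ∀ x, K.Adj v x → level x < level v := fun x hvx =>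
    (hmax x (hv.trans hvx.reachable)).lt_of_ne (h.level_ne_of_adj hK htri hvx).symm
  exact ⟨v, hv, fun x y hx hy => h.eq_of_adj_of_level_lt hK htri hx hy (hlt x hx) (hlt y hy)⟩

/-- The components of `K` on `S` are laid out along the integers: `f` tells the vertices of a
component apart and changes by at most one along an edge. -/
structure IsPositionOn (K : SimpleGraph V) (S : Set V) (f : V → ℕ) : Prop where
  le_add_one : ∀ u ∈ S, ∀ v ∈ S, K.Adj u v → f v ≤ f u + 1
  injOn : ∀ ⦃u v⦄, ReachableIn K S u v → f u = f v → u = v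

theorem IsPositionOn.mono {T : Set V} (h : IsPositionOn K T f) (hST : S ⊆ T) :
    IsPositionOn K S f :=
  ⟨fun u hu v hv => h.le_add_one u (hST hu) v (hST hv), fun _ _ huv => h.injOn (huv.mono_set hST)⟩

theorem IsLayering.isPositionOn_univ (h : IsLayering K level root)
    (hleaf : ∀ v x y, K.Adj (root v) x → K.Adj (root v) y → x = y)
    (hdeg : ∀ ⦃c x y z⦄, K.Adj c x → K.Adj c y → K.Adj c z → x = y ∨ x = z ∨ y = z) :
    IsPositionOn K Set.univ level := by
  refine ⟨fun u _ v _ huv => h.level_le huv, fun u v huv => ?_⟩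
  have hroot := h.root_eq_of_reachableIn huv
  clear huv
  induction hu : level u generalizing u v with
  | zero => exact fun hv => by rw [← h.eq_root hu, ← h.eq_root hv.symm, hroot]
  | succ n ih =>
    intro hv
    obtain ⟨w, huw, hw⟩ := h.exists_parent (hu.trans_ne n.succ_ne_zero)
    obtain ⟨w', hvw, hw'⟩ := h.exists_parent (hv.symm.trans_ne n.succ_ne_zero)
    obtain rfl : w = w' := ih w w' ((h.root_eq huw).symm.trans (hroot.trans (h.root_eq hvw)))
      (by omega) (by omega)
    by_cases hw0 : level w = 0
    · rw [← h.eq_root hw0] at huw hvw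
      exact hleaf w u v huw.symm hvw.symm
    · obtain ⟨x, hwx, hx⟩ := h.exists_parent hw0
      rcases hdeg huw.symm hvw.symm hwx with huv | rfl | rfl
      · exact huv
      · omega
      · omega

theorem IsChordal.exists_isPositionOn_univ [Finite V] (hK : IsChordal K)
    (htri : ∀ ⦃x y z⦄, K.Adj x y → K.Adj x z → ¬ K.Adj y z)
    (hdeg : ∀ ⦃c x y z⦄, K.Adj c x → K.Adj c y → K.Adj c z → x = y ∨ x = z ∨ y = z) :
    ∃ f, IsPositionOn K Set.univ f := by
  choose leaf hreach hleaf using hK.exists_leaf htri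
  have h := isLayering_dist (G := K) (root := fun v => leaf (K.connectedComponentMk v).out)
    (fun v => (hreach _).symm.trans (SimpleGraph.ConnectedComponent.exact (Quot.out_eq _)))
    (fun _ _ huv => by rw [SimpleGraph.ConnectedComponent.sound huv.reachable])
  exact ⟨_, h.isPositionOn_univ (fun v => hleaf _) hdeg⟩

theorem div_eq_div_of_not_dvd {m a b : ℕ} (ha : ¬ m ∣ a) (hb : ¬ m ∣ b) (hab : a ≤ b + 1)
    (hba : b ≤ a + 1) : a / m = b / m := by
  rcases (by omega : a = b ∨ a = b + 1 ∨ b = a + 1) with rfl | rfl | rfl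
  · rfl
  · rw [Nat.succ_div, if_neg ha, add_zero]
  · rw [Nat.succ_div, if_neg hb, add_zero]

theorem IsPositionOn.add_mod {m s : ℕ} (h : IsPositionOn K S f)
    (hS : ∀ v ∈ S, ¬ m ∣ f v + s) : IsPositionOn K S fun v => (f v + s) % m := by
  have hdiv : ∀ u ∈ S, ∀ v ∈ S, K.Adj u v → (f u + s) / m = (f v + s) / m :=
    fun u hu v hv huv => div_eq_div_of_not_dvd (hS u hu) (hS v hv)
      (by linarith [h.le_add_one v hv u hu huv.symm]) (by linarith [h.le_add_one u hu v hv huv])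
  refine ⟨fun u hu v hv huv => ?_, fun u v huv hmod => h.injOn huv ?_⟩
  · have := h.le_add_one u hu v hv huv
    have hfu := Nat.div_add_mod (f u + s) m
    have hfv := Nat.div_add_mod (f v + s) m
    rw [hdiv u hu v hv huv] at hfu
    omega
  · have hfu := Nat.div_add_mod (f u + s) m
    rw [huv.eq_of_invariant hdiv, hmod, Nat.div_add_mod] at hfu
    omega

end LinearForest

section Ranking

variable {V α β γ : Type*} {G : SimpleGraph V} {S : Set V} {u v : V}

/-- `φ` is a ranking of the subgraph of `G` induced by `S`: every connected part of it has at most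
one vertex of smallest rank. Ranks grow away from the roots of a treedepth witness. -/
def IsRankingOn [Preorder α] (G : SimpleGraph V) (S : Set V) (φ : V → α) : Prop :=
  ∀ ⦃u v⦄, φ u = φ v → ReachableIn G (S ∩ {w | φ u ≤ φ w}) u v → u = v

theorem IsRankingOn.congr_of_blocks [PartialOrder α] [PartialOrder γ] {φ : V → α} {φ' : V → γ}
    (h : IsRankingOn G S φ) {block : V → β}
    (hblock : ∀ u ∈ S, ∀ v ∈ S, G.Adj u v → block u = block v)
    (hφ : ∀ u v, block u = block v → (φ u ≤ φ v ↔ φ' u ≤ φ' v)) : IsRankingOn G S φ' := by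
  intro u v heq hr
  have huv : block u = block v :=
    hr.eq_of_invariant fun x hx y hy hxy => hblock x hx.1 y hy.1 hxy
  refine h (le_antisymm ((hφ u v huv).2 heq.le) ((hφ v u huv.symm).2 heq.ge)) ?_
  have hr' := hr.inter_of_invariant (T := {w | block u = block w}) huv
    fun x hx y hy hxy hyu => hyu.trans (hblock x hx.1 y hy.1 hxy).symm
  exact hr'.mono_set fun w hw => ⟨hw.1.1, (hφ u w hw.2).2 hw.1.2⟩

theorem IsRankingOn.induce [Preorder α] {φ : V → α} (h : IsRankingOn G S φ) :
    IsRankingOn (G.induce S) Set.univ fun v => φ v := by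
  intro u v heq hr
  exact Subtype.ext (h heq (hr.map (fun x hx => ⟨x.2, hx.2⟩) fun _ _ _ _ => id))

section Layering

variable {level : V → ℕ} {root : V → V}

theorem IsLayering.isRankingOn_lex [PartialOrder α] (h : IsLayering G level root)
    (hG : IsChordal G) {ψ : V → α} (hψ : IsRankingOn (sameLayer G level) S ψ) :
    IsRankingOn G S fun v => toLex (level v, ψ v) := by
  intro u v heq hr
  obtain ⟨hlevel, hψuv⟩ : level u = level v ∧ ψ u = ψ v := Prod.ext_iff.1 (toLex_inj.1 heq)
  refine hψ hψuv ?_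
  have hlayer := h.reachableIn_sameLayer hG
    (fun w hw => hlevel.ge.trans (Prod.Lex.toLex_le_toLex'.1 hw.2).1) hlevel hr
  refine (hlayer.inter_of_invariant (T := {w | level u = level w}) hlevel
    fun x _ y _ hxy hy => Eq.trans hy hxy.2.symm).mono_set fun w hw => ⟨hw.1.1, ?_⟩
  exact (Prod.Lex.toLex_le_toLex'.1 hw.1.2).2 hw.2

theorem IsLayering.isRankingOn_mod [PartialOrder α] (h : IsLayering G level root)
    (hG : IsChordal G) {ψ : V → α} (hψ : IsRankingOn (sameLayer G level) S ψ) {m s : ℕ}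
    (hS : ∀ v ∈ S, ¬ m ∣ level v + s) :
    IsRankingOn G S fun v => toLex ((level v + s) % m, ψ v) := by
  refine (h.isRankingOn_lex hG hψ).congr_of_blocks (block := fun v => (level v + s) / m)
    (fun u hu v hv huv => div_eq_div_of_not_dvd (hS u hu) (hS v hv)
      (by linarith [h.level_le huv.symm]) (by linarith [h.level_le huv])) fun u v hdiv => ?_
  have hu := Nat.div_add_mod (level u + s) m
  have hv := Nat.div_add_mod (level v + s) m
  rw [hdiv] at hu
  have hlt : level u < level v ↔ (level u + s) % m < (level v + s) % m := by omega
  have heq : level u = level v ↔ (level u + s) % m = (level v + s) % m := by omega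
  simp only [Prod.Lex.toLex_le_toLex, hlt, heq]

end Layering

theorem exists_padicValNat_two_lt {p q : ℕ} (hp : 0 < p) (hpq : p < q)
    (hval : padicValNat 2 p = padicValNat 2 q) :
    ∃ r, p < r ∧ r < q ∧ padicValNat 2 p < padicValNat 2 r := by
  have hodd : ∀ n, 0 < n → ∃ k, n = 2 ^ padicValNat 2 n * k ∧ ¬ 2 ∣ k := fun n hn => by
    obtain ⟨k, hk⟩ := pow_padicValNat_dvd (p := 2) (n := n)
    refine ⟨k, hk, fun ⟨l, hl⟩ => pow_succ_padicValNat_not_dvd (p := 2) hn.ne' ⟨l, ?_⟩⟩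
    rw [pow_succ, mul_assoc, ← hl]
    exact hk
  obtain ⟨k, hk, hk2⟩ := hodd p hp
  obtain ⟨l, hl, hl2⟩ := hodd q (hp.trans hpq)
  rw [← hval] at hl
  set e := padicValNat 2 p
  have hkl : k < l := lt_of_mul_lt_mul_left' (a := 2 ^ e) (by omega)
  refine ⟨2 ^ e * (k + 1), ?_, ?_, ?_⟩
  · rw [hk]
    gcongr
    omega
  · rw [hl]
    gcongr
    omega
  · refine (padicValNat_dvd_iff_le (by positivity)).1 ?_
    rw [pow_succ]
    exact Nat.mul_dvd_mul_left _ (by omega)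

/-- Between two positions of equal `2`-adic valuation there is one of larger valuation. -/
theorem IsPositionOn.isRankingOn_padicValNat {K : SimpleGraph V} {f : V → ℕ}
    (h : IsPositionOn K S f) (hS : ∀ v ∈ S, f v ≠ 0) :
    IsRankingOn K S fun v => OrderDual.toDual (padicValNat 2 (f v)) := by
  have hle : ∀ u v, padicValNat 2 (f u) = padicValNat 2 (f v) →
      ReachableIn K (S ∩ {w | padicValNat 2 (f w) ≤ padicValNat 2 (f u)}) u v → f v ≤ f u := by
    intro u v hval hr
    by_contra! hlt
    obtain ⟨r, hur, hrv, hr2⟩ :=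
      exists_padicValNat_two_lt (Nat.pos_of_ne_zero (hS u hr.mem_left.1)) hlt hval
    obtain ⟨w, hw, rfl⟩ := hr.exists_eq_of_le_of_le
      (fun x hx y hy => h.le_add_one x hx.1 y hy.1) hur.le hrv.le
    exact hw.2.not_gt hr2
  intro u v heq hr
  have hval : padicValNat 2 (f u) = padicValNat 2 (f v) := OrderDual.toDual_inj.1 heq
  have hr' := hr.symm
  rw [heq] at hr'
  exact h.injOn (hr.mono_set Set.inter_subset_left)
    ((hle v u hval.symm hr').antisymm (hle u v hval hr))

end Ranking

section Treedepth

theorem le_of_lt_of_covBy_of_isChain {V : Type*} [PartialOrder V] {p u v : V}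
    (hchain : IsChain (· ≤ ·) (Set.Iic v)) (hu : u < v) (hp : p ⋖ v) : u ≤ p := by
  rcases hchain.total (show u ∈ Set.Iic v from hu.le) (show p ∈ Set.Iic v from hp.le)
    with hup | hpu
  · exact hup
  · exact (hpu.eq_of_not_lt fun hlt => hp.2 hlt hu).ge

theorem exists_rootedForest {V : Type*} [Finite V] [PartialOrder V]
    (hchain : ∀ v : V, IsChain (· ≤ ·) (Set.Iic v)) :
    ∃ F : RootedForest V,
      (∀ u v, u ≤ v → F.IsAncestor u v) ∧ ∀ v, F.depth v = (Set.Iio v).ncard := by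
  classical
  let parent (v : V) : Option V := if h : ∃ p, p ⋖ v then some h.choose else none
  have covBy_of_parent : ∀ v p, parent v = some p → p ⋖ v := fun v p hp => by
    obtain ⟨h, hp⟩ := Option.dite_none_right_eq_some.1 hp
    obtain rfl := Option.some_inj.1 hp
    exact h.choose_spec
  have exists_parent : ∀ u v, u < v → ∃ p, parent v = some p := fun u v huv => by
    obtain ⟨p, -, hp⟩ := exists_le_covBy_of_lt huv
    exact ⟨_, dif_pos ⟨p, hp⟩⟩
  refine ⟨⟨parent, fun v => (Set.Iio v).ncard, fun v hv => ?_, fun v p hp => ?_⟩,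
    fun u v => ?_, fun v => rfl⟩
  · suffices Set.Iio v = ∅ by rw [this, Set.ncard_empty]
    refine Set.eq_empty_of_forall_notMem fun u hu => ?_
    obtain ⟨p, hp⟩ := exists_parent u v hu
    exact Option.some_ne_none p (hp.symm.trans hv)
  · have hpv := covBy_of_parent v p hp
    have hIio : Set.Iio v = Set.Iic p := Set.ext fun u =>
      ⟨fun hu => le_of_lt_of_covBy_of_isChain (hchain v) hu hpv, fun hu => hu.trans_lt hpv.lt⟩
    rw [hIio, ← Set.Iio_insert, Set.ncard_insert_of_notMem Set.self_notMem_Iio]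
  · induction v using WellFoundedLT.induction with
    | ind v ih =>
      intro huv
      rcases huv.eq_or_lt with rfl | huv
      · exact Relation.ReflTransGen.refl
      · obtain ⟨p, hp⟩ := exists_parent u v huv
        have hpv := covBy_of_parent v p hp
        exact .head hp (ih p hpv.lt (le_of_lt_of_covBy_of_isChain (hchain v) huv hpv))

/-- The order of the treedepth witness given by a ranking: `u` lies below the vertices that are
joined to it through vertices of rank at least `φ u`. -/
abbrev IsRankingOn.ancestorOrder {V α : Type*} [PartialOrder α] {G : SimpleGraph V} {φ : V → α}
    (h : IsRankingOn G Set.univ φ) : PartialOrder V where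
  le u v := ReachableIn G (Set.univ ∩ {w | φ u ≤ φ w}) u v
  le_refl u := .refl ⟨trivial, le_rfl⟩
  le_trans u v w huv hvw :=
    huv.trans (hvw.mono_set fun _ hx => ⟨trivial, huv.mem_right.2.trans hx.2⟩)
  le_antisymm u v huv hvu := h (huv.mem_right.2.antisymm hvu.mem_right.2) huv

theorem IsRankingOn.hasTreedepthAtMost {V : Type*} {α : Type*} [Finite V] [LinearOrder α]
    {G : SimpleGraph V} {φ : V → α} (h : IsRankingOn G Set.univ φ) :
    HasTreedepthAtMost G (Set.range φ).ncard := by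
  let _ := h.ancestorOrder
  have hle {u v w : V} (huv : ReachableIn G (Set.univ ∩ {x | φ u ≤ φ x}) u v) (hwv : w ≤ v)
      (huw : φ u ≤ φ w) : u ≤ w :=
    huv.trans (hwv.symm.mono_set fun _ hx => ⟨trivial, huw.trans hx.2⟩)
  have hchain (v : V) : IsChain (· ≤ ·) (Set.Iic v) := fun u hu w hw _ =>
    (le_total (φ u) (φ w)).imp (hle hu hw) (hle hw hu)
  obtain ⟨F, hF, hdepth⟩ := exists_rootedForest hchain
  refine ⟨F, fun v => ?_, fun u v huv => (le_total (φ u) (φ v)).imp (fun hφ => ?_) fun hφ => ?_⟩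
  · have hinj : Set.InjOn φ (Set.Iic v) := fun u hu w hw huw =>
      le_antisymm (hle hu hw huw.le) (hle hw hu huw.ge)
    calc F.depth v = (Set.Iio v).ncard := hdepth v
      _ < (Set.Iic v).ncard :=
        Set.ncard_lt_ncard Set.Iio_ssubset_Iic_self
      _ = (φ '' Set.Iic v).ncard := hinj.ncard_image.symm
      _ ≤ (Set.range φ).ncard := Set.ncard_le_ncard (Set.image_subset_range _ _)
  · exact hF u v (.of_adj huv ⟨trivial, le_rfl⟩ ⟨trivial, hφ⟩)
  · exact hF v u (.of_adj huv.symm ⟨trivial, le_rfl⟩ ⟨trivial, hφ⟩)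

theorem IsRankingOn.treedepth_induce_le {V : Type*} {α : Type*} [Finite V] [LinearOrder α]
    {G : SimpleGraph V} {S : Set V} {φ : V → α} (h : IsRankingOn G S φ) :
    treedepth (G.induce S) ≤ (φ '' S).ncard := by
  rw [Set.image_eq_range]
  exact Nat.sInf_le h.induce.hasTreedepthAtMost

end Treedepth

section Counting

theorem ncard_image_toLex_prodMk_le {V α β : Type*} [Finite V] (S : Set V) (φ : V → α)
    (ψ : V → β) :
    ((fun v => toLex (φ v, ψ v)) '' S).ncard ≤ (φ '' S).ncard * (ψ '' S).ncard := by
  rw [← Set.ncard_prod]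
  calc ((fun v => toLex (φ v, ψ v)) '' S).ncard
      ≤ (toLex '' ((φ '' S) ×ˢ (ψ '' S))).ncard := by
        refine Set.ncard_le_ncard ?_ (Set.toFinite _)
        rintro _ ⟨v, hv, rfl⟩
        exact ⟨(φ v, ψ v), ⟨⟨v, hv, rfl⟩, ⟨v, hv, rfl⟩⟩, rfl⟩
    _ ≤ ((φ '' S) ×ˢ (ψ '' S)).ncard := Set.ncard_image_le (Set.toFinite _)

theorem ncard_image_le_of_lt {V : Type*} {S : Set V} {f : V → ℕ} {m : ℕ}
    (hf : ∀ v ∈ S, f v < m) : (f '' S).ncard ≤ m := by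
  refine (Set.ncard_le_ncard (t := Set.Iio m) (Set.image_subset_iff.2 hf)
    (Set.finite_Iio m)).trans_eq ?_
  rw [← Finset.coe_Iio, Set.ncard_coe_finset, Nat.card_Iio]

theorem card_filter_dvd_add {m n : ℕ} (hmn : m ∣ n) (hm : 0 < m) (x : ℕ) :
    ((Finset.range n).filter fun k => m ∣ x + k).card = n / m := by
  obtain ⟨c, rfl⟩ := hmn
  have hcount := Nat.count_add (p := fun k => k ≡ 0 [MOD m]) x (m * c)
  simp only [Nat.count_modEq_card _ hm, Nat.add_mul_div_left _ _ hm,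
    Nat.add_mul_mod_self_left] at hcount
  simp only [Nat.modEq_zero_iff_dvd] at hcount
  rw [← Nat.count_eq_card_filter_range, Nat.mul_div_cancel_left c hm]
  omega

theorem card_filter_dvd_add_or_le {m₁ m₂ m₃ n : ℕ} (h₁ : m₁ ∣ n) (h₂ : m₂ ∣ n) (h₃ : m₃ ∣ n)
    (hn : 0 < n) (x y z : ℕ) :
    ((Finset.range n).filter fun k => m₁ ∣ x + k ∨ m₂ ∣ y + k ∨ m₃ ∣ z + k).card ≤
      n / m₁ + (n / m₂ + n / m₃) := by
  rw [Finset.filter_or, Finset.filter_or, ← card_filter_dvd_add h₁ (Nat.pos_of_dvd_of_pos h₁ hn) x,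
    ← card_filter_dvd_add h₂ (Nat.pos_of_dvd_of_pos h₂ hn) y,
    ← card_filter_dvd_add h₃ (Nat.pos_of_dvd_of_pos h₃ hn) z]
  exact (Finset.card_union_le _ _).trans (by gcongr; exact Finset.card_union_le _ _)

end Counting

section RandomDeletion

variable {V : Type*} [Finite V] {G : SimpleGraph V}

theorem IsLayering.treedepth_induce_le_of_not_dvd {x y z : V → ℕ} {r r' : V → V}
    (hx : IsLayering G x r) (hG : IsChordal G) (hy : IsLayering (sameLayer G x) y r')
    (hz : IsPositionOn (sameLayer (sameLayer G x) y) Set.univ z) {S : Set V} {m₁ m₂ m₃ t k : ℕ}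
    (hm₁ : 0 < m₁) (hm₂ : 0 < m₂) (hm₃ : 0 < m₃) (ht : m₃ ≤ 2 ^ t)
    (hS : ∀ v ∈ S, ¬ m₁ ∣ x v + k ∧ ¬ m₂ ∣ y v + k ∧ ¬ m₃ ∣ z v + k) :
    treedepth (G.induce S) ≤ m₁ * (m₂ * t) := by
  have hpos : ∀ v ∈ S, (z v + k) % m₃ ≠ 0 := fun v hv h =>
    (hS v hv).2.2 (Nat.dvd_of_mod_eq_zero h)
  have hval : ∀ v ∈ S, padicValNat 2 ((z v + k) % m₃) < t := fun v hv => by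
    refine (Nat.pow_lt_pow_iff_right one_lt_two).1 ?_
    calc 2 ^ padicValNat 2 ((z v + k) % m₃) ≤ (z v + k) % m₃ :=
          Nat.le_of_dvd (Nat.pos_of_ne_zero (hpos v hv)) pow_padicValNat_dvd
      _ < m₃ := Nat.mod_lt _ hm₃
      _ ≤ 2 ^ t := ht
  have hrank := hx.isRankingOn_mod hG
    (hy.isRankingOn_mod (hG.sameLayer x)
      (((hz.mono (Set.subset_univ S)).add_mod fun v hv => (hS v hv).2.2).isRankingOn_padicValNat
        hpos)
      fun v hv => (hS v hv).2.1)
    fun v hv => (hS v hv).1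
  refine hrank.treedepth_induce_le.trans ((ncard_image_toLex_prodMk_le _ _ _).trans ?_)
  refine Nat.mul_le_mul (ncard_image_le_of_lt fun v _ => Nat.mod_lt _ hm₁)
    ((ncard_image_toLex_prodMk_le _ _ _).trans ?_)
  exact Nat.mul_le_mul (ncard_image_le_of_lt fun v _ => Nat.mod_lt _ hm₂)
    (ncard_image_le_of_lt hval)

theorem IsPlanar.exists_treedepth_induce_le (hG : IsPlanar G) (hc : IsChordal G) :
    ∃ x y z : V → ℕ, ∀ m₁ m₂ m₃ t k : ℕ, 0 < m₁ → 0 < m₂ → 0 < m₃ → m₃ ≤ 2 ^ t →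
      treedepth (G.induce {v | m₁ ∣ x v + k ∨ m₂ ∣ y v + k ∨ m₃ ∣ z v + k}ᶜ) ≤
        m₁ * (m₂ * t) := by
  obtain ⟨x, r, hx⟩ := exists_isLayering G
  obtain ⟨y, r', hy⟩ := exists_isLayering (sameLayer G x)
  obtain ⟨z, hz⟩ := ((hc.sameLayer x).sameLayer y).exists_isPositionOn_univ
    (fun _ _ _ => hG.not_adj_sameLayer_sameLayer hx hy)
    (fun _ _ _ _ => hG.eq_or_eq_or_eq_of_adj_sameLayer_sameLayer hx hy)
  refine ⟨x, y, z, fun m₁ m₂ m₃ t k hm₁ hm₂ hm₃ ht => ?_⟩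
  refine hx.treedepth_induce_le_of_not_dvd hc hy hz hm₁ hm₂ hm₃ ht (k := k) fun v hv => ?_
  simpa only [Set.mem_compl_iff, Set.mem_ofPred_eq, not_or] using hv

open scoped Classical in
theorem exists_pmf_isThin {V ι : Type*} {s : Finset ι} (hs : s.Nonempty) {a : ℕ} (ha : 0 < a)
    (D : ι → Set V) (hD : ∀ v, {i ∈ s | v ∈ D i}.card * a ≤ s.card) :
    ∃ μ : PMF (Set V), μ.support ⊆ D '' s ∧ IsThin (1 / (a : ℝ)) μ := by
  refine ⟨(PMF.uniformOfFinset s hs).map D, ?_, fun v => ?_⟩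
  · rw [PMF.support_map, PMF.support_uniformOfFinset]
  · rw [PMF.toOuterMeasure_map_apply, PMF.toOuterMeasure_uniformOfFinset_apply,
      ENNReal.ofReal_div_of_pos (by exact_mod_cast ha), ENNReal.ofReal_one,
      ENNReal.ofReal_natCast]
    refine ENNReal.div_le_of_le_mul ?_
    rw [mul_comm, mul_one_div, ENNReal.le_div_iff_mul_le (.inl (by exact_mod_cast ha.ne'))
      (.inl (ENNReal.natCast_ne_top a))]
    exact_mod_cast hD v

theorem four_mul_le_two_pow {a : ℕ} (ha : 0 < a) :
    4 * a ≤ 2 ^ (2 + ⌈Real.logb 2 (a : ℝ)⌉₊) := by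
  have hlog : (a : ℝ) ≤ 2 ^ ⌈Real.logb 2 (a : ℝ)⌉₊ := by
    rw [← Real.rpow_natCast, ← Real.logb_le_iff_le_rpow one_lt_two (by exact_mod_cast ha)]
    exact Nat.le_ceil _
  rw [pow_add]
  exact Nat.mul_le_mul_left 4 (by exact_mod_cast hlog)

theorem monotone_rate :
    Monotone fun a : ℕ => 8 * (a : ℝ≥0) ^ 2 * (2 + (⌈Real.logb 2 (a : ℝ)⌉₊ : ℝ≥0)) := by
  intro a b hab
  rcases Nat.eq_zero_or_pos a with rfl | ha
  · simp
  dsimp only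
  gcongr
  exact one_lt_two

end RandomDeletion

end Fragility

theorem mainTheorem9 :
    Fragility.GraphClass.IsFractionallyFragile Fragility.planarChordal.{u} Fragility.td.{u}
      (fun a : ℕ => 8 * (a : ℝ≥0) ^ 2 * (2 + (⌈Real.logb 2 (a : ℝ)⌉₊ : ℝ≥0))) := by
  rintro V _ G ⟨hG, hc⟩
  refine ⟨Fragility.monotone_rate, fun a ha => ?_⟩
  obtain ⟨x, y, z, htd⟩ := hG.exists_treedepth_induce_le hc
  obtain ⟨μ, hμ, hthin⟩ := Fragility.exists_pmf_isThin (s := Finset.range (4 * a)) (by simp; omega)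
    ha (fun k => {v | 2 * a ∣ x v + k ∨ 4 * a ∣ y v + k ∨ 4 * a ∣ z v + k}) fun v => by
      have hcard := Fragility.card_filter_dvd_add_or_le (m₁ := 2 * a) (n := 4 * a) ⟨2, by ring⟩
        dvd_rfl dvd_rfl (by omega) (x v) (y v) (z v)
      rw [Nat.mul_div_mul_right _ _ ha, Nat.div_self (by omega)] at hcard
      rw [Finset.card_range]
      convert Nat.mul_le_mul_right a hcard
      exact Iff.rfl
  refine ⟨μ, fun Y hY => ?_, hthin⟩
  obtain ⟨k, -, rfl⟩ := hμ hY
  have hle := htd (2 * a) (4 * a) (4 * a) (2 + ⌈Real.logb 2 a⌉₊) k (by omega) (by omega)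
    (by omega) (Fragility.four_mul_le_two_pow ha)
  refine (NNReal.coe_le_coe.2 (Nat.cast_le.2 hle)).trans_eq ?_
  push_cast
  ring
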